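/- Let $F(w)=\frac12 w^\top A w+b^\top w+c$ on $\mathbb R^d$ be a quadratic function, where $A$ is a symmetric real matrix, and suppose that $F$ has a minimizer $w^*$. For $\mu>0$ call $F$ convex and $\mu$-smooth if all eigenvalues of $A$ lie in $[0,\mu]$, and for $0<\lambda\le\mu$ call $F$ $\lambda$-strongly convex and $\mu$-smooth if they all lie in $[\lambda,\mu]$. Let $\tau\ge 0$ be an integer, $\sigma\ge 0$, and let $\xi_0,\xi_1,\dots$ be independent random vectors in $\mathbb R^d$ with $\mathbb E[\xi_k]=0$ and $\mathbb E\|\xi_k\|^2\le\sigma^2$. Stochastic delayed gradient descent with delay $\tau$ and step size $\eta$ is defined by a deterministic $w_0=w_1=\dots=w_\tau$ and $$w_{k+1}=w_k-\eta\,(\nabla F(w_{k-\tau})+\xi_k)\qquad(k\ge\tau).$$ Let $k$ be an integer with $k\ge(\tau+1)\ln(2(\tau+1))$. (1) If $F$ is $\lambda$-strongly convex and $\mu$-smooth and $0<\eta\le\frac1{20\mu(\tau+1)}$, then $\mathbb E[F(w_k)-F(w^*)]$ exists and is at most $$5\mu e^{-2\eta\lambda(k+1)}\|w_0-w^*\|^2+\frac{\eta^2\sigma^2}{2}\Big(\mu(\tau+1)\ln(2(\tau+1))+\frac{1+e+\ln\frac1{\eta\lambda}}{e\eta}\Big).$$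 (2) There are absolute constants $C>0$ and $p\in\mathbb N$ such that for $T=\tau$ (if $\tau\ge1$) and also for $T=\tau+1$ there is a step size $\eta\in(0,\frac1{20\mu T}]$, depending only on $\lambda,\mu,\tau,T,k,\sigma$ and $\|w_0-w^*\|$, with which for every $\lambda$-strongly convex, $\mu$-smooth $F$ $$\mathbb E[F(w_k)-F(w^*)]\le C L^p\Big(\frac{\sigma^2}{\lambda k}+\mu\|w_0-w^*\|^2\exp\Big(-\frac{\lambda k}{10\mu T}\Big)\Big),\qquad L=1+\ln(1+k)+\ln\Big(1+\frac{\lambda\mu\|w_0-w^*\|^2k}{\sigma^2}\Big),$$ where the last logarithm is omitted if $\sigma=0$. For $T=\tau\ge1$ this is the bound $\tilde{\mathcal O}\big(\frac{\sigma^2}{\lambda k}+\mu\|w_0-w^*\|^2\exp(-\frac{\lambda k}{10\mu\tau})\big)$. (3) If $F$ is convex and $\mu$-smooth and $0<\eta\le\frac1{20\mu(\tau+1)}$, then $\mathbb E[F(w_k)-F(w^*)]$ exists and is at most $$\frac{9\|w_0-w^*\|^2}{4e\eta(k+1)}+\eta^2\sigma^2\Big(\mu(\tau+1)\ln(2(\tau+1))+\frac{9}{2e\eta}(1+\ln(k+1))\Big).$$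 (4) There are absolute constants $C>0$ and $p\in\mathbb N$ such that for $T=\tau$ (if $\tau\ge1$) and also for $T=\tau+1$ there is a step size $\eta\in[0,\frac1{20\mu T}]$, positive if $w_0\ne w^*$ and depending only on $\mu,\tau,T,k,\sigma$ and $\|w_0-w^*\|$, with which for every convex $\mu$-smooth $F$ $$\mathbb E[F(w_k)-F(w^*)]\le C(1+\ln(1+k))^p\Big(\frac{\|w_0-w^*\|\sigma}{\sqrt k}+\frac{\mu T\|w_0-w^*\|^2}{k}\Big).$$ For $T=\tau\ge1$ this is the bound $\tilde{\mathcal O}\big(\frac{\|w_0-w^*\|\sigma}{\sqrt k}+\frac{\mu\tau\|w_0-w^*\|^2}{k}\big)$. -/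

import Mathlib

open MeasureTheory ProbabilityTheory Matrix

universe u

/-- The quadratic function `F(w) = (1/2) wᵀ A w + bᵀ w + c` on Euclidean space. -/
noncomputable def quadratic {d : ℕ} (A : Matrix (Fin d) (Fin d) ℝ)
    (b : EuclideanSpace ℝ (Fin d)) (c : ℝ) (w : EuclideanSpace ℝ (Fin d)) : ℝ :=
  (1 / 2) * (w.ofLp ⬝ᵥ (A *ᵥ w.ofLp)) + b.ofLp ⬝ᵥ w.ofLp + c

/-- `F` is a quadratic function whose (symmetric) matrix has all its eigenvalues in `[lo, hi]`.
For `lo = 0` these are the convex `hi`-smooth quadratics, and for `lo > 0` the `lo`-strongly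
convex `hi`-smooth quadratics. -/
def IsQuadraticWithSpectrumIn {d : ℕ} (lo hi : ℝ) (F : EuclideanSpace ℝ (Fin d) → ℝ) : Prop :=
  ∃ (A : Matrix (Fin d) (Fin d) ℝ) (b : EuclideanSpace ℝ (Fin d)) (c : ℝ) (hA : A.IsHermitian),
    (∀ i, hA.eigenvalues i ∈ Set.Icc lo hi) ∧ F = quadratic A b c

/-- `ξ 0, ξ 1, …` are independent random vectors with mean zero and `𝔼 ‖ξ k‖² ≤ σ²`. -/
structure IsNoise {d : ℕ} {Ω : Type u} [MeasurableSpace Ω] (P : Measure Ω) (σ : ℝ)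
    (ξ : ℕ → Ω → EuclideanSpace ℝ (Fin d)) : Prop where
  measurable : ∀ k, Measurable (ξ k)
  indep : iIndepFun ξ P
  memLp : ∀ k, MemLp (ξ k) 2 P
  mean_zero : ∀ k, ∫ ω, ξ k ω ∂P = 0
  variance_le : ∀ k, ∫ ω, ‖ξ k ω‖ ^ 2 ∂P ≤ σ ^ 2

/-- `w 0, w 1, …` are the iterates of stochastic delayed gradient descent on `F` with delay `τ`,
step size `η`, starting point `w₀` and noise `ξ`:
`w 0 = ⋯ = w τ = w₀` and `w (k+1) = w k - η (∇F (w (k-τ)) + ξ k)` for `k ≥ τ`. -/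
structure IsSDGD {d : ℕ} {Ω : Type u} (F : EuclideanSpace ℝ (Fin d) → ℝ) (τ : ℕ) (η : ℝ)
    (w₀ : EuclideanSpace ℝ (Fin d)) (ξ : ℕ → Ω → EuclideanSpace ℝ (Fin d))
    (w : ℕ → Ω → EuclideanSpace ℝ (Fin d)) : Prop where
  init : ∀ k, k ≤ τ → ∀ ω, w k ω = w₀
  step : ∀ k, τ ≤ k → ∀ ω, w (k + 1) ω = w k ω - η • (gradient F (w (k - τ) ω) + ξ k ω)

/-- Every run of stochastic delayed gradient descent with delay `τ`, step size `η` and noise of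
variance at most `σ²`, on every quadratic (in any dimension) with spectrum in `[lo, hi]`, started
at distance `R` from a minimizer `wstar`, satisfies `𝔼 [F (w k) - F wstar] ≤ B`; this expectation
exists. -/
def SDGDGuarantee (lo hi σ : ℝ) (τ : ℕ) (η R : ℝ) (k : ℕ) (B : ℝ) : Prop :=
  ∀ (d : ℕ) (F : EuclideanSpace ℝ (Fin d) → ℝ) (wstar w₀ : EuclideanSpace ℝ (Fin d))
    (Ω : Type u) [MeasurableSpace Ω] (P : Measure Ω) [IsProbabilityMeasure P]
    (ξ w : ℕ → Ω → EuclideanSpace ℝ (Fin d)),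
    IsQuadraticWithSpectrumIn lo hi F → (∀ v, F wstar ≤ F v) → ‖w₀ - wstar‖ = R →
    IsNoise P σ ξ → IsSDGD F τ η w₀ ξ w →
    Integrable (fun ω => F (w k ω) - F wstar) P ∧ ∫ ω, (F (w k ω) - F wstar) ∂P ≤ B

/-!
In an eigenbasis of the Hessian, each coordinate of the deviation from the minimizer satisfies a
scalar recursion `y (n + 1) = y n - (x * y (n - τ) + η * z n)` with `x = η * a`, `a` an eigenvalue
and `z` the corresponding noise coordinate. By variation of constants, `y` is a combination of the
initial value and the noise with coefficients taken from the fundamental solution `delayKernel τ x`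
(`eq_delayKernel_convolution`). Independence makes the cross terms vanish in expectation, so the
expected excess is bounded by the maxima over the spectrum of `a * delayKernel τ (η * a) m ^ 2`
(`SDGDGuarantee.of_kernel_bound`).

The kernel behaves like `exp (-x m)`, the rate without delay. For small `x * (τ + 1)` it is
positive and decreasing, and a decreasing kernel satisfies `u (m + 1) ≤ (1 - x) * u m` once
`m ≥ τ`; the first `τ` steps, where nothing decays, cost only the factor
`(1 - x) ^ (-(τ + 1)) ≤ 10 / 9` (`delayKernel_sq_le`). Hence no burn-in is needed. The condition
`10 * x * (τ + 1) ≤ 1` used for this also covers step sizes up to `1 / (20 * μ * τ)` when `τ ≥ 1`.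

It remains to maximize `a * exp (-2 η a (m + 1))` over the spectrum and to sum over `m`. Using
`a * exp (-t a) ≤ 1 / (e t)` alone gives a harmonic sum and a logarithm of the time; keeping a part
of the exponential gives the series of `-log (1 - exp (-η λ / 2))` and a logarithm of `1 / (η λ)`.
The tuned rates take the largest admissible step size or the one balancing bias and variance,
whichever is smaller; in the strongly convex case they need the logarithm of the time, since no
logarithm of the condition number is allowed there.
-/

/-! ### The fundamental solution of the scalar delayed recursion -/

/-- The fundamental solution of the scalar recursion `y (n + 1) = y n - x * y (n - τ)`: the solution
with value `1` at time `0` and value `0` at all negative times. -/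
noncomputable def delayKernel (τ : ℕ) (x : ℝ) : ℕ → ℝ
  | 0 => 1
  | n + 1 => delayKernel τ x n - x * (if τ ≤ n then delayKernel τ x (n - τ) else 0)
termination_by n => n
decreasing_by all_goals omega

lemma delayKernel_zero (τ : ℕ) (x : ℝ) : delayKernel τ x 0 = 1 := by
  rw [delayKernel]

lemma delayKernel_succ_of_lt {τ n : ℕ} (x : ℝ) (h : n < τ) :
    delayKernel τ x (n + 1) = delayKernel τ x n := by
  rw [delayKernel, if_neg (by omega)]; ring

lemma delayKernel_succ_of_le {τ n : ℕ} (x : ℝ) (h : τ ≤ n) :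
    delayKernel τ x (n + 1) = delayKernel τ x n - x * delayKernel τ x (n - τ) := by
  rw [delayKernel, if_pos h]

lemma delayKernel_of_le {τ n : ℕ} (x : ℝ) (h : n ≤ τ) : delayKernel τ x n = 1 := by
  induction n with
  | zero => exact delayKernel_zero τ x
  | succ n ih => rw [delayKernel_succ_of_lt x (by omega), ih (by omega)]

/-- For `10 x (τ + 1) ≤ 1` the kernel is positive, decreasing, and shrinks by at most the factor
`1 - 2 x` per step. The third property is what keeps the kernel positive: over one delay it gives
`delayKernel τ x (n - τ) ≤ 2 * delayKernel τ x n`, which in turn reproduces it. -/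
lemma delayKernel_pos_and_ratio {τ : ℕ} {x : ℝ} (hx : 0 ≤ x) (hxτ : 10 * x * (τ + 1) ≤ 1) (n : ℕ) :
    0 < delayKernel τ x n ∧ delayKernel τ x (n + 1) ≤ delayKernel τ x n ∧
      (1 - 2 * x) * delayKernel τ x n ≤ delayKernel τ x (n + 1) := by
  have hxτ0 : 0 ≤ x * τ := by positivity
  have hx10 : 10 * x ≤ 1 := by nlinarith
  induction n using Nat.strong_induction_on with
  | _ n ih =>
    have hpos : 0 < delayKernel τ x n := by
      rcases n with _ | n
      · rw [delayKernel_zero]; norm_num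
      · obtain ⟨h1, -, h3⟩ := ih n (by omega)
        exact lt_of_lt_of_le (mul_pos (by linarith) h1) h3
    refine ⟨hpos, ?_⟩
    rcases lt_or_ge n τ with h | h
    · rw [delayKernel_succ_of_lt x h]
      exact ⟨le_rfl, by nlinarith⟩
    · have key : ∀ i, i ≤ τ →
          (1 - 2 * x) ^ i * delayKernel τ x (n - τ) ≤ delayKernel τ x (n - τ + i) := by
        intro i
        induction i with
        | zero => simp
        | succ i ihi =>
          intro hi
          have h3 := (ih (n - τ + i) (by omega)).2.2
          calc (1 - 2 * x) ^ (i + 1) * delayKernel τ x (n - τ)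
              = (1 - 2 * x) * ((1 - 2 * x) ^ i * delayKernel τ x (n - τ)) := by ring
            _ ≤ (1 - 2 * x) * delayKernel τ x (n - τ + i) :=
                mul_le_mul_of_nonneg_left (ihi (by omega)) (by linarith)
            _ ≤ _ := h3
      have hτ := key τ le_rfl
      rw [Nat.sub_add_cancel h] at hτ
      have hbern : 1 / 2 ≤ (1 - 2 * x) ^ τ := by
        have := one_add_mul_le_pow (a := -(2 * x)) (by linarith) τ
        rw [← sub_eq_add_neg] at this
        nlinarith
      have hpos' : 0 < delayKernel τ x (n - τ) := by
        rcases Nat.eq_zero_or_pos τ with h0 | h0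
        · simpa [h0] using hpos
        · exact (ih (n - τ) (by omega)).1
      have htwo : delayKernel τ x (n - τ) ≤ 2 * delayKernel τ x n := by nlinarith
      rw [delayKernel_succ_of_le x h]
      constructor <;> nlinarith

/-- The kernel decays at the rate of undelayed gradient descent, up to a constant factor. -/
lemma delayKernel_sq_le {τ : ℕ} {x : ℝ} (hx : 0 ≤ x) (hxτ : 10 * x * (τ + 1) ≤ 1) (n : ℕ) :
    delayKernel τ x n ^ 2 ≤ 5 / 4 * Real.exp (-2 * x * (n + 1)) := by
  have hxτ0 : 0 ≤ x * τ := by positivity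
  have hx10 : 10 * x ≤ 1 := by nlinarith
  have hP := delayKernel_pos_and_ratio hx hxτ
  have hanti : Antitone (delayKernel τ x) := antitone_nat_of_succ_le fun n => (hP n).2.1
  have hpow : delayKernel τ x n * (1 - x) ^ τ ≤ (1 - x) ^ n := by
    induction n with
    | zero => rw [delayKernel_zero, one_mul]; exact pow_le_pow_of_le_one (by linarith) (by linarith)
                (Nat.zero_le _)
    | succ n ih =>
      rcases lt_or_ge n τ with h | h
      · rw [delayKernel_of_le x h, one_mul]
        exact pow_le_pow_of_le_one (by linarith) (by linarith) h
      · have h1 : delayKernel τ x (n + 1) ≤ (1 - x) * delayKernel τ x n := by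
          rw [delayKernel_succ_of_le x h]
          nlinarith [hanti (Nat.sub_le n τ)]
        calc delayKernel τ x (n + 1) * (1 - x) ^ τ
            ≤ (1 - x) * delayKernel τ x n * (1 - x) ^ τ :=
              mul_le_mul_of_nonneg_right h1 (pow_nonneg (by linarith) _)
          _ = (1 - x) * (delayKernel τ x n * (1 - x) ^ τ) := by ring
          _ ≤ (1 - x) * (1 - x) ^ n := mul_le_mul_of_nonneg_left ih (by linarith)
          _ = _ := by ring
  have hbern : 9 / 10 ≤ (1 - x) ^ (τ + 1) := by
    have := one_add_mul_le_pow (a := -x) (by linarith) (τ + 1)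
    rw [← sub_eq_add_neg] at this
    push_cast at this
    nlinarith
  have hexp : (1 - x) ^ (n + 1) ≤ Real.exp (-x * (n + 1)) := by
    have := pow_le_pow_left₀ (by linarith) (Real.one_sub_le_exp_neg x) (n + 1)
    rw [← Real.exp_nat_mul] at this
    refine this.trans_eq ?_
    push_cast; ring_nf
  have hpos := (hP n).1
  have hlin : 9 / 10 * delayKernel τ x n ≤ Real.exp (-x * (n + 1)) := by
    refine le_trans ?_ hexp
    calc 9 / 10 * delayKernel τ x n ≤ (1 - x) ^ (τ + 1) * delayKernel τ x n :=
          mul_le_mul_of_nonneg_right hbern hpos.le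
      _ = (1 - x) * (delayKernel τ x n * (1 - x) ^ τ) := by ring
      _ ≤ (1 - x) * (1 - x) ^ n := mul_le_mul_of_nonneg_left hpow (by linarith)
      _ = _ := by ring
  have hsq := pow_le_pow_left₀ (by positivity) hlin 2
  rw [← Real.exp_nat_mul] at hsq
  have he : ((2 : ℕ) : ℝ) * (-x * (n + 1)) = -2 * x * (n + 1) := by push_cast; ring
  rw [he] at hsq
  nlinarith [Real.exp_pos (-2 * x * (n + 1))]

/-- Variation of constants: a delayed recursion with forcing `z`, constant up to time `τ`, is the
kernel applied to the initial value minus the convolution of the kernel with the forcing. -/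
lemma eq_delayKernel_convolution {τ : ℕ} {x η : ℝ} {y z : ℕ → ℝ}
    (hinit : ∀ k, k ≤ τ → y k = y 0)
    (hstep : ∀ k, τ ≤ k → y (k + 1) = y k - (x * y (k - τ) + η * z k)) (k : ℕ) :
    y k = delayKernel τ x k * y 0
      - η * ∑ j ∈ Finset.Ico τ k, delayKernel τ x (k - 1 - j) * z j := by
  induction k using Nat.strong_induction_on with
  | _ k ih =>
    rcases le_or_gt k τ with h | h
    · rw [delayKernel_of_le x h, hinit k h, Finset.Ico_eq_empty_of_le h]; simp
    · obtain ⟨n, rfl⟩ : ∃ n, k = n + 1 := ⟨k - 1, by omega⟩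
      have hn : τ ≤ n := by omega
      rw [hstep n hn, ih n (by omega), ih (n - τ) (by omega), delayKernel_succ_of_le x hn,
        Finset.sum_Ico_succ_top hn]
      have hconv : ∑ j ∈ Finset.Ico τ n, delayKernel τ x (n + 1 - 1 - j) * z j
          = ∑ j ∈ Finset.Ico τ n, delayKernel τ x (n - 1 - j) * z j
            - x * ∑ j ∈ Finset.Ico τ (n - τ), delayKernel τ x (n - τ - 1 - j) * z j := by
        -- The delayed part of the kernel recursion reaches only the forcing at `j < n - τ`.
        have hsub : Finset.Ico τ (n - τ) ⊆ Finset.Ico τ n :=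
          Finset.Ico_subset_Ico le_rfl (Nat.sub_le _ _)
        have hext : ∑ j ∈ Finset.Ico τ (n - τ), delayKernel τ x (n - τ - 1 - j) * z j
            = ∑ j ∈ Finset.Ico τ n,
              if j < n - τ then delayKernel τ x (n - τ - 1 - j) * z j else 0 := by
          rw [← Finset.sum_subset hsub]
          · refine Finset.sum_congr rfl fun j hj => ?_
            rw [if_pos (Finset.mem_Ico.1 hj).2]
          · intro j hj hj'
            simp only [Finset.mem_Ico] at hj hj'
            rw [if_neg (by omega)]
        rw [hext, Finset.mul_sum, ← Finset.sum_sub_distrib]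
        refine Finset.sum_congr rfl fun j hj => ?_
        obtain ⟨h1, h2⟩ := Finset.mem_Ico.1 hj
        have e1 : n + 1 - 1 - j = (n - 1 - j) + 1 := by omega
        rw [e1]
        split_ifs with h3
        · rw [delayKernel_succ_of_le x (by omega), show n - 1 - j - τ = n - τ - 1 - j by omega]
          ring
        · rw [delayKernel_succ_of_lt x (by omega)]; ring
      rw [hconv, show n + 1 - 1 - n = 0 by omega, delayKernel_zero]
      ring

/-! ### Quadratics in the eigenbasis -/

lemma quadratic_eq_inner {d : ℕ} (A : Matrix (Fin d) (Fin d) ℝ)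
    (b : EuclideanSpace ℝ (Fin d)) (c : ℝ) (w : EuclideanSpace ℝ (Fin d)) :
    quadratic A b c w
      = 1 / 2 * inner ℝ w (toEuclideanCLM (𝕜 := ℝ) A w) + inner ℝ b w + c := by
  simp [quadratic, EuclideanSpace.inner_eq_star_dotProduct, Matrix.ofLp_toEuclideanCLM,
    dotProduct_comm]

lemma inner_toEuclideanCLM_comm {d : ℕ} {A : Matrix (Fin d) (Fin d) ℝ} (hA : A.IsHermitian)
    (v w : EuclideanSpace ℝ (Fin d)) :
    inner ℝ (toEuclideanCLM (𝕜 := ℝ) A v) w = inner ℝ v (toEuclideanCLM (𝕜 := ℝ) A w) :=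
  isSymmetric_toEuclideanLin_iff.2 hA v w

lemma hasGradientAt_quadratic {d : ℕ} {A : Matrix (Fin d) (Fin d) ℝ} (hA : A.IsHermitian)
    (b : EuclideanSpace ℝ (Fin d)) (c : ℝ) (w : EuclideanSpace ℝ (Fin d)) :
    HasGradientAt (quadratic A b c) (toEuclideanCLM (𝕜 := ℝ) A w + b) w := by
  rw [hasGradientAt_iff_hasFDerivAt]
  have h1 := (((hasFDerivAt_id (𝕜 := ℝ) w).inner ℝ
    ((toEuclideanCLM (𝕜 := ℝ) A).hasFDerivAt (x := w))).const_mul (1 / 2 : ℝ)).add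
    ((innerSL ℝ b).hasFDerivAt (x := w)) |>.add_const c
  have h2 : quadratic A b c = fun w => 1 / 2 * inner ℝ w (toEuclideanCLM (𝕜 := ℝ) A w)
      + inner ℝ b w + c := funext (quadratic_eq_inner A b c)
  rw [h2]
  refine HasFDerivAt.congr_fderiv h1 ?_
  ext v
  have h3 : inner ℝ v (toEuclideanCLM (𝕜 := ℝ) A w)
      = inner ℝ w (toEuclideanCLM (𝕜 := ℝ) A v) := by
    rw [← inner_toEuclideanCLM_comm hA, real_inner_comm]
  simp only [one_div, id_eq, _root_.add_apply, FunLike.coe_smul,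
    ContinuousLinearMap.coe_comp, Pi.smul_apply, Function.comp_apply,
    ContinuousLinearMap.prod_apply, ContinuousLinearMap.coe_id', fderivInnerCLM_apply, h3,
    smul_eq_mul, innerSL_apply_apply, map_add, InnerProductSpace.toDual_apply_apply,
    inner_toEuclideanCLM_comm hA]
  ring

lemma toEuclideanCLM_add_eq_zero_of_isMin {d : ℕ} {A : Matrix (Fin d) (Fin d) ℝ}
    (hA : A.IsHermitian) {b : EuclideanSpace ℝ (Fin d)} {c : ℝ}
    {wstar : EuclideanSpace ℝ (Fin d)}
    (hmin : ∀ v, quadratic A b c wstar ≤ quadratic A b c v) :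
    toEuclideanCLM (𝕜 := ℝ) A wstar + b = 0 := by
  have h := IsLocalMin.hasFDerivAt_eq_zero (Filter.Eventually.of_forall hmin)
    (hasGradientAt_iff_hasFDerivAt.1 (hasGradientAt_quadratic hA b c wstar))
  exact (InnerProductSpace.toDual ℝ _).map_eq_zero_iff.1 h

lemma inner_eigenvectorBasis_toEuclideanCLM {d : ℕ} {A : Matrix (Fin d) (Fin d) ℝ}
    (hA : A.IsHermitian) (i : Fin d) (v : EuclideanSpace ℝ (Fin d)) :
    inner ℝ (hA.eigenvectorBasis i) (toEuclideanCLM (𝕜 := ℝ) A v)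
      = hA.eigenvalues i * inner ℝ (hA.eigenvectorBasis i) v := by
  have h : toEuclideanCLM (𝕜 := ℝ) A (hA.eigenvectorBasis i)
      = hA.eigenvalues i • hA.eigenvectorBasis i := by
    apply (WithLp.equiv 2 _).injective
    simpa [Matrix.ofLp_toEuclideanCLM] using hA.mulVec_eigenvectorBasis i
  rw [← inner_toEuclideanCLM_comm hA, h, real_inner_smul_left]

/-- The excess over the minimum is the quadratic form of the deviation from the minimizer,
diagonalized in the eigenbasis. -/
lemma quadratic_sub_min {d : ℕ} {A : Matrix (Fin d) (Fin d) ℝ}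
    (hA : A.IsHermitian) {b : EuclideanSpace ℝ (Fin d)} {c : ℝ}
    {wstar : EuclideanSpace ℝ (Fin d)} (hcrit : toEuclideanCLM (𝕜 := ℝ) A wstar + b = 0)
    (w : EuclideanSpace ℝ (Fin d)) :
    quadratic A b c w - quadratic A b c wstar
      = ∑ i, 1 / 2 * hA.eigenvalues i * inner ℝ (hA.eigenvectorBasis i) (w - wstar) ^ 2 := by
  have hb : b = -toEuclideanCLM (𝕜 := ℝ) A wstar := by
    rw [add_comm] at hcrit; exact eq_neg_of_add_eq_zero_left hcrit
  have h1 : quadratic A b c w - quadratic A b c wstar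
      = 1 / 2 * inner ℝ (w - wstar) (toEuclideanCLM (𝕜 := ℝ) A (w - wstar)) := by
    have h2 : inner ℝ wstar (toEuclideanCLM (𝕜 := ℝ) A w)
        = inner ℝ w (toEuclideanCLM (𝕜 := ℝ) A wstar) := by
      rw [← inner_toEuclideanCLM_comm hA, real_inner_comm]
    simp only [quadratic_eq_inner, hb, map_sub, inner_sub_left, inner_sub_right, inner_neg_left,
      inner_toEuclideanCLM_comm hA, h2]
    ring
  rw [h1, ← hA.eigenvectorBasis.sum_inner_mul_inner, Finset.mul_sum]
  refine Finset.sum_congr rfl fun i _ => ?_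
  rw [inner_eigenvectorBasis_toEuclideanCLM, real_inner_comm]
  ring

/-! ### The expected excess of a run -/

/-- The second moment of an affine combination of centred, pairwise independent variables: the cross
terms vanish. -/
lemma integral_affine_sum_sq {Ω : Type u} [MeasurableSpace Ω] {P : Measure Ω}
    [IsProbabilityMeasure P] {z : ℕ → Ω → ℝ} (hL2 : ∀ j, MemLp (z j) 2 P)
    (hindep : Pairwise fun i j => z i ⟂ᵢ[P] z j) (hmean : ∀ j, ∫ ω, z j ω ∂P = 0)
    (s : Finset ℕ) (a η : ℝ) (b : ℕ → ℝ) :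
    Integrable (fun ω => (a - η * ∑ j ∈ s, b j * z j ω) ^ 2) P ∧
      ∫ ω, (a - η * ∑ j ∈ s, b j * z j ω) ^ 2 ∂P
        = a ^ 2 + η ^ 2 * ∑ j ∈ s, b j ^ 2 * ∫ ω, z j ω ^ 2 ∂P := by
  have hbL2 : ∀ j, MemLp (fun ω => b j * z j ω) 2 P := fun j => (hL2 j).const_mul (b j)
  have hS : MemLp (fun ω => ∑ j ∈ s, b j * z j ω) 2 P := memLp_finsetSum s fun j _ => hbL2 j
  have hSint : Integrable (fun ω => ∑ j ∈ s, b j * z j ω) P := hS.integrable one_le_two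
  have hS0 : ∫ ω, ∑ j ∈ s, b j * z j ω ∂P = 0 := by
    rw [integral_finsetSum s fun j _ => (hbL2 j).integrable one_le_two]
    simp [integral_const_mul, hmean]
  have hvar : ∫ ω, (∑ j ∈ s, b j * z j ω) ^ 2 ∂P
      = ∑ j ∈ s, b j ^ 2 * ∫ ω, z j ω ^ 2 ∂P := by
    have h1 := IndepFun.variance_sum (μ := P) (s := s) (X := fun j ω => b j * z j ω)
      (fun j _ => hbL2 j) (fun i _ j _ hij =>
        (hindep hij).comp (measurable_const_mul (b i)) (measurable_const_mul (b j)))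
    have h2 : (∑ j ∈ s, fun ω => b j * z j ω) = fun ω => ∑ j ∈ s, b j * z j ω := by
      ext ω; simp
    rw [h2, variance_of_integral_eq_zero hS.aestronglyMeasurable.aemeasurable hS0] at h1
    rw [h1]
    refine Finset.sum_congr rfl fun j _ => ?_
    rw [variance_const_mul, variance_of_integral_eq_zero
      (hL2 j).aestronglyMeasurable.aemeasurable (hmean j)]
  have hexp : ∀ ω, (a - η * ∑ j ∈ s, b j * z j ω) ^ 2
      = (a ^ 2 - 2 * a * η * ∑ j ∈ s, b j * z j ω) + η ^ 2 * (∑ j ∈ s, b j * z j ω) ^ 2 := by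
    intro ω; ring
  simp_rw [hexp]
  have hi1 : Integrable (fun ω => a ^ 2 - 2 * a * η * ∑ j ∈ s, b j * z j ω) P :=
    (integrable_const _).sub (hSint.const_mul _)
  have hi2 : Integrable (fun ω => η ^ 2 * (∑ j ∈ s, b j * z j ω) ^ 2) P :=
    hS.integrable_sq.const_mul _
  refine ⟨hi1.add hi2, ?_⟩
  rw [integral_add hi1 hi2, integral_sub (integrable_const _) (hSint.const_mul _),
    integral_const_mul, integral_const_mul, hS0, hvar]
  simp

/-- The expected excess splits into a bias and a variance part, each governed by
`a * delayKernel τ (η * a) m ^ 2` for `a` in the spectrum. Since the covariance of the noise may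
change with time, the supremum over the spectrum is taken separately for every `m`. -/
lemma SDGDGuarantee.of_kernel_bound {lo hi σ η R B β : ℝ} {τ k : ℕ} {s : ℕ → ℝ}
    (hβ : ∀ a ∈ Set.Icc lo hi, a * delayKernel τ (η * a) k ^ 2 ≤ β)
    (hs : ∀ m, ∀ a ∈ Set.Icc lo hi, a * delayKernel τ (η * a) m ^ 2 ≤ s m) (hs0 : ∀ m, 0 ≤ s m)
    (hB : 1 / 2 * R ^ 2 * β + 1 / 2 * η ^ 2 * σ ^ 2 * ∑ m ∈ Finset.range k, s m ≤ B) :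
    SDGDGuarantee.{u} lo hi σ τ η R k B := by
  rintro d F wstar w₀ Ω _ P _ ξ w ⟨A, b, c, hA, hspec, rfl⟩ hmin hR hξ hw
  have hcrit := toEuclideanCLM_add_eq_zero_of_isMin hA hmin
  set v := hA.eigenvectorBasis with hv
  set l := hA.eigenvalues with hl
  let y : Fin d → ℕ → Ω → ℝ := fun i n ω => inner ℝ (v i) (w n ω - wstar)
  let z : Fin d → ℕ → Ω → ℝ := fun i n ω => inner ℝ (v i) (ξ n ω)
  let y₀ : Fin d → ℝ := fun i => inner ℝ (v i) (w₀ - wstar)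
  have hy0 : ∀ i n ω, n ≤ τ → y i n ω = y₀ i := fun i n ω h => by
    simp only [y, y₀, hw.init n h ω]
  have hy : ∀ i ω, y i k ω = delayKernel τ (η * l i) k * y₀ i
      - η * ∑ j ∈ Finset.Ico τ k, delayKernel τ (η * l i) (k - 1 - j) * z i j ω := by
    intro i ω
    rw [← hy0 i 0 ω (Nat.zero_le _)]
    refine eq_delayKernel_convolution (y := fun n => y i n ω) (z := fun n => z i n ω)
      (fun n hn => by rw [hy0 i n ω hn, hy0 i 0 ω (Nat.zero_le _)]) (fun n hn => ?_) k
    have hgrad : gradient (quadratic A b c) (w (n - τ) ω)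
        = toEuclideanCLM (𝕜 := ℝ) A (w (n - τ) ω - wstar) := by
      rw [(hasGradientAt_quadratic hA b c _).gradient, map_sub]
      rw [add_comm] at hcrit
      rw [eq_neg_of_add_eq_zero_left hcrit]
      abel
    simp only [y, z]
    rw [hw.step n hn ω, hgrad, sub_right_comm, inner_sub_right, real_inner_smul_right,
      inner_add_right, inner_eigenvectorBasis_toEuclideanCLM]
    ring
  have hzL2 : ∀ i j, MemLp (z i j) 2 P := fun i j => (hξ.memLp j).const_inner (v i)
  have hzmean : ∀ i j, ∫ ω, z i j ω ∂P = 0 := fun i j => by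
    simp only [z]
    rw [integral_inner ((hξ.memLp j).integrable one_le_two), hξ.mean_zero j, inner_zero_right]
  have hzindep : ∀ i, Pairwise fun p q => z i p ⟂ᵢ[P] z i q := fun i p q hpq =>
    (hξ.indep.indepFun hpq).comp (φ := fun e => inner ℝ (v i) e) (ψ := fun e => inner ℝ (v i) e)
      (by fun_prop) (by fun_prop)
  have hmoment : ∀ i, Integrable (fun ω => y i k ω ^ 2) P ∧ ∫ ω, y i k ω ^ 2 ∂P
      = (delayKernel τ (η * l i) k * y₀ i) ^ 2 + η ^ 2 * ∑ j ∈ Finset.Ico τ k,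
        delayKernel τ (η * l i) (k - 1 - j) ^ 2 * ∫ ω, z i j ω ^ 2 ∂P := fun i => by
    simp_rw [hy i]
    exact integral_affine_sum_sq (hzL2 i) (hzindep i) (hzmean i) _ _ _ _
  have hval : ∀ ω, quadratic A b c (w k ω) - quadratic A b c wstar
      = ∑ i, 1 / 2 * l i * y i k ω ^ 2 := fun ω => quadratic_sub_min hA hcrit _
  simp_rw [hval]
  have hint : ∀ i ∈ Finset.univ, Integrable (fun ω => 1 / 2 * l i * y i k ω ^ 2) P :=
    fun i _ => (hmoment i).1.const_mul _
  refine ⟨integrable_finsetSum _ hint, le_trans ?_ hB⟩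
  rw [integral_finsetSum _ hint]
  simp_rw [integral_const_mul, (hmoment _).2]
  have hzsum : ∀ j, ∑ i, ∫ ω, z i j ω ^ 2 ∂P ≤ σ ^ 2 := fun j => by
    rw [← integral_finsetSum _ fun i _ => (hzL2 i j).integrable_sq]
    refine le_trans (le_of_eq ?_) (hξ.variance_le j)
    congr 1
    ext ω
    rw [← v.sum_sq_norm_inner_right]
    simp [z]
  have hysum : ∑ i, y₀ i ^ 2 = R ^ 2 := by
    rw [← hR, ← v.sum_sq_norm_inner_right]
    simp [y₀]
  have hbias : ∑ i, l i * delayKernel τ (η * l i) k ^ 2 * y₀ i ^ 2 ≤ β * R ^ 2 := by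
    rw [← hysum, Finset.mul_sum]
    exact Finset.sum_le_sum fun i _ =>
      mul_le_mul_of_nonneg_right (hβ (l i) (hspec i)) (sq_nonneg _)
  have hnoise : ∑ i, l i * ∑ j ∈ Finset.Ico τ k,
        delayKernel τ (η * l i) (k - 1 - j) ^ 2 * ∫ ω, z i j ω ^ 2 ∂P
      ≤ σ ^ 2 * ∑ m ∈ Finset.range k, s m := by
    simp_rw [Finset.mul_sum]
    rw [Finset.sum_comm, ← Finset.sum_range_reflect]
    refine le_trans (Finset.sum_le_sum fun j _ => ?_)
      (Finset.sum_le_sum_of_subset_of_nonneg (f := fun j => σ ^ 2 * s (k - 1 - j)) ?_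
        fun j _ _ => mul_nonneg (sq_nonneg _) (hs0 _))
    · calc ∑ i, l i * (delayKernel τ (η * l i) (k - 1 - j) ^ 2 * ∫ ω, z i j ω ^ 2 ∂P)
          ≤ ∑ i, s (k - 1 - j) * ∫ ω, z i j ω ^ 2 ∂P := Finset.sum_le_sum fun i _ => by
            rw [← mul_assoc]
            exact mul_le_mul_of_nonneg_right (hs _ (l i) (hspec i))
              (integral_nonneg fun ω => sq_nonneg _)
        _ = s (k - 1 - j) * ∑ i, ∫ ω, z i j ω ^ 2 ∂P := by rw [Finset.mul_sum]
        _ ≤ s (k - 1 - j) * σ ^ 2 := mul_le_mul_of_nonneg_left (hzsum j) (hs0 _)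
        _ = σ ^ 2 * s (k - 1 - j) := mul_comm _ _
    · intro j hj
      exact Finset.mem_range.2 (Finset.mem_Ico.1 hj).2
  calc ∑ i, 1 / 2 * l i * ((delayKernel τ (η * l i) k * y₀ i) ^ 2 + η ^ 2 *
        ∑ j ∈ Finset.Ico τ k, delayKernel τ (η * l i) (k - 1 - j) ^ 2 * ∫ ω, z i j ω ^ 2 ∂P)
      = 1 / 2 * ∑ i, l i * delayKernel τ (η * l i) k ^ 2 * y₀ i ^ 2
        + 1 / 2 * η ^ 2 * ∑ i, l i * ∑ j ∈ Finset.Ico τ k,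
          delayKernel τ (η * l i) (k - 1 - j) ^ 2 * ∫ ω, z i j ω ^ 2 ∂P := by
        rw [Finset.mul_sum, Finset.mul_sum, ← Finset.sum_add_distrib]
        exact Finset.sum_congr rfl fun i _ => by ring
    _ ≤ 1 / 2 * (β * R ^ 2) + 1 / 2 * η ^ 2 * (σ ^ 2 * ∑ m ∈ Finset.range k, s m) := by
        gcongr
    _ = _ := by ring

/-! ### Sums of maxima over the spectrum -/

lemma mul_exp_neg_mul_le (a : ℝ) {t : ℝ} (ht : 0 < t) :
    a * Real.exp (-(t * a)) ≤ 1 / (Real.exp 1 * t) := by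
  have h := Real.mul_exp_neg_le_exp_neg_one (t * a)
  rw [Real.exp_neg 1] at h
  rw [one_div, mul_inv, ← div_eq_mul_inv, le_div_iff₀ ht]
  linarith

lemma sum_range_one_div_succ_le (k : ℕ) :
    ∑ m ∈ Finset.range k, 1 / ((m : ℝ) + 1) ≤ 1 + Real.log k := by
  have h := harmonic_le_one_add_log k
  simpa [harmonic] using h

lemma sum_range_exp_div_succ_le {y : ℝ} (hy : 0 < y) (k : ℕ) :
    ∑ m ∈ Finset.range k, Real.exp (-(y * (m + 1))) / ((m : ℝ) + 1) ≤ Real.log (1 / y) + y := by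
  have hlt : Real.exp (-y) < 1 := by simpa using hy
  have hsum := Real.hasSum_pow_div_log_of_abs_lt_one (x := Real.exp (-y))
    (by rwa [abs_of_pos (Real.exp_pos _)])
  have hle := sum_le_hasSum (Finset.range k) (fun m _ => by positivity) hsum
  have hlow : y / (1 + y) ≤ 1 - Real.exp (-y) := by
    have h1 : Real.exp (-y) ≤ 1 / (1 + y) := by
      rw [Real.exp_neg, ← one_div]
      exact one_div_le_one_div_of_le (by linarith) (by linarith [Real.add_one_le_exp y])
    have h2 : y / (1 + y) = 1 - 1 / (1 + y) := by field_simp; ring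
    linarith
  have hlog : Real.log y - Real.log (1 + y) ≤ Real.log (1 - Real.exp (-y)) := by
    rw [← Real.log_div hy.ne' (by positivity)]
    exact Real.log_le_log (by positivity) hlow
  have hlog' : Real.log (1 + y) ≤ y := by
    linarith [Real.log_le_sub_one_of_pos (show 0 < 1 + y by linarith)]
  have heq : ∀ m : ℕ, Real.exp (-(y * (m + 1))) = Real.exp (-y) ^ (m + 1) := fun m => by
    rw [← Real.exp_nat_mul]; push_cast; ring_nf
  simp_rw [heq]
  rw [one_div, Real.log_inv]
  linarith

/-! ### Fixed step sizes -/

/-- `SDGDGuarantee.of_kernel_bound` with the kernel replaced by its exponential bound. -/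
lemma SDGDGuarantee.of_exp_bound {lo hi σ η R B β : ℝ} {τ k : ℕ} {s : ℕ → ℝ} (hlo : 0 ≤ lo)
    (hη : 0 ≤ η) (hητ : 10 * (η * hi) * (τ + 1) ≤ 1)
    (hβ : ∀ a ∈ Set.Icc lo hi, a * Real.exp (-2 * (η * a) * (k + 1)) ≤ β)
    (hs : ∀ m : ℕ, ∀ a ∈ Set.Icc lo hi, a * Real.exp (-2 * (η * a) * (m + 1)) ≤ s m)
    (hs0 : ∀ m, 0 ≤ s m)
    (hB : 5 / 8 * (R ^ 2 * β + η ^ 2 * σ ^ 2 * ∑ m ∈ Finset.range k, s m) ≤ B) :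
    SDGDGuarantee.{u} lo hi σ τ η R k B := by
  have hker : ∀ m : ℕ, ∀ a ∈ Set.Icc lo hi, a * delayKernel τ (η * a) m ^ 2
      ≤ 5 / 4 * (a * Real.exp (-2 * (η * a) * (m + 1))) := by
    intro m a ha
    have ha0 : 0 ≤ a := hlo.trans ha.1
    have hx : 10 * (η * a) * (τ + 1) ≤ 1 := by
      refine le_trans ?_ hητ
      gcongr
      exact ha.2
    calc a * delayKernel τ (η * a) m ^ 2
        ≤ a * (5 / 4 * Real.exp (-2 * (η * a) * (m + 1))) :=
          mul_le_mul_of_nonneg_left (delayKernel_sq_le (mul_nonneg hη ha0) hx m) ha0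
      _ = _ := by ring
  refine SDGDGuarantee.of_kernel_bound (β := 5 / 4 * β) (s := fun m => 5 / 4 * s m)
    (fun a ha => (hker k a ha).trans (by linarith [hβ a ha]))
    (fun m a ha => (hker m a ha).trans (by linarith [hs m a ha]))
    (fun m => by linarith [hs0 m]) (le_trans (le_of_eq ?_) hB)
  rw [← Finset.mul_sum]
  ring

lemma mul_exp_le_one_div {η : ℝ} (hη : 0 < η) (a : ℝ) (m : ℕ) :
    a * Real.exp (-2 * (η * a) * (m + 1)) ≤ 1 / (2 * Real.exp 1 * η) * (1 / ((m : ℝ) + 1)) := by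
  have h := mul_exp_neg_mul_le a (t := 2 * η * (m + 1)) (by positivity)
  calc a * Real.exp (-2 * (η * a) * (m + 1)) = a * Real.exp (-(2 * η * (m + 1) * a)) := by ring_nf
    _ ≤ _ := h
    _ = _ := by field_simp

lemma mul_exp_le_of_mem_Icc {lam μ η a : ℝ} (hlam : 0 < lam) (hη : 0 ≤ η)
    (ha : a ∈ Set.Icc lam μ) (k : ℕ) :
    a * Real.exp (-2 * (η * a) * (k + 1)) ≤ μ * Real.exp (-2 * η * lam * (k + 1)) := by
  have h1 : Real.exp (-2 * (η * a) * (k + 1)) ≤ Real.exp (-2 * η * lam * (k + 1)) := by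
    refine Real.exp_le_exp.2 ?_
    have h : η * lam * (k + 1) ≤ η * a * (k + 1) := by
      have := ha.1
      gcongr
    linarith
  exact mul_le_mul ha.2 h1 (Real.exp_pos _).le (by linarith [ha.1, ha.2])

/-- Strongly convex quadratics, with a variance term that stays bounded in `k`. A quarter of the
exponent pays for the summability of the maxima `a * exp (-2 η a n)` over the spectrum; the rest
keeps the coefficient of the logarithm below `1 / 2`. -/
lemma SDGDGuarantee.strongly_convex {lam μ σ η R : ℝ} {τ : ℕ} (k : ℕ) (hlam : 0 < lam)
    (hη : 0 < η) (hητ : 10 * (η * μ) * (τ + 1) ≤ 1) :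
    SDGDGuarantee.{u} lam μ σ τ η R k
      (5 / 8 * (R ^ 2 * (μ * Real.exp (-2 * η * lam * (k + 1))) + η ^ 2 * σ ^ 2 *
        (2 / (3 * Real.exp 1 * η) * (Real.log (1 / (η * lam / 2)) + η * lam / 2)))) := by
  refine SDGDGuarantee.of_exp_bound hlam.le hη.le hητ
    (s := fun m => 2 / (3 * Real.exp 1 * η)
      * (Real.exp (-(η * lam / 2 * (m + 1))) / ((m : ℝ) + 1)))
    (fun a ha => mul_exp_le_of_mem_Icc hlam hη.le ha k) (fun m a ha => ?_) (fun m => by positivity) ?_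
  · have h := mul_exp_neg_mul_le a (t := 3 / 2 * η * (m + 1)) (by positivity)
    have h2 : Real.exp (-(η * a / 2 * (m + 1))) ≤ Real.exp (-(η * lam / 2 * (m + 1))) := by
      have := ha.1
      gcongr
    calc a * Real.exp (-2 * (η * a) * (m + 1))
        = a * Real.exp (-(3 / 2 * η * (m + 1) * a)) * Real.exp (-(η * a / 2 * (m + 1))) := by
          rw [mul_assoc a, ← Real.exp_add]; ring_nf
      _ ≤ 1 / (Real.exp 1 * (3 / 2 * η * (m + 1))) * Real.exp (-(η * lam / 2 * (m + 1))) :=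
          mul_le_mul h h2 (Real.exp_pos _).le (by positivity)
      _ = _ := by field_simp
  · rw [← Finset.mul_sum]
    have := sum_range_exp_div_succ_le (y := η * lam / 2) (by positivity) k
    gcongr

lemma SDGDGuarantee.convex {μ σ η R : ℝ} {τ : ℕ} (k : ℕ)
    (hη : 0 < η) (hητ : 10 * (η * μ) * (τ + 1) ≤ 1) :
    SDGDGuarantee.{u} 0 μ σ τ η R k
      (5 / 8 * (R ^ 2 * (1 / (2 * Real.exp 1 * η) * (1 / ((k : ℝ) + 1))) + η ^ 2 * σ ^ 2 *
        (1 / (2 * Real.exp 1 * η) * (1 + Real.log k)))) := by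
  refine SDGDGuarantee.of_exp_bound le_rfl hη.le hητ
    (fun a _ => mul_exp_le_one_div hη a k) (fun m a _ => mul_exp_le_one_div hη a m)
    (fun m => by positivity) ?_
  rw [← Finset.mul_sum]
  have := sum_range_one_div_succ_le k
  gcongr

/-- Strongly convex quadratics, with the variance term of the convex case. Its logarithm is that of
the time instead of the condition number, as the tuned rate requires. -/
lemma SDGDGuarantee.strongly_convex_log_time {lam μ σ η R : ℝ} {τ : ℕ} (k : ℕ) (hlam : 0 < lam)
    (hη : 0 < η) (hητ : 10 * (η * μ) * (τ + 1) ≤ 1) :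
    SDGDGuarantee.{u} lam μ σ τ η R k
      (5 / 8 * (R ^ 2 * (μ * Real.exp (-2 * η * lam * (k + 1))) + η ^ 2 * σ ^ 2 *
        (1 / (2 * Real.exp 1 * η) * (1 + Real.log k)))) := by
  refine SDGDGuarantee.of_exp_bound hlam.le hη.le hητ
    (fun a ha => mul_exp_le_of_mem_Icc hlam hη.le ha k) (fun m a _ => mul_exp_le_one_div hη a m)
    (fun m => by positivity) ?_
  · rw [← Finset.mul_sum]
    have := sum_range_one_div_succ_le k
    gcongr

lemma SDGDGuarantee.mono {lo hi σ η R B B' : ℝ} {τ k : ℕ}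
    (h : SDGDGuarantee.{u} lo hi σ τ η R k B) (hB : B ≤ B') :
    SDGDGuarantee.{u} lo hi σ τ η R k B' :=
  fun d F wstar w₀ Ω _ P _ ξ w hF hmin hR hξ hw =>
    ⟨(h d F wstar w₀ Ω P ξ w hF hmin hR hξ hw).1,
      (h d F wstar w₀ Ω P ξ w hF hmin hR hξ hw).2.trans hB⟩

lemma ten_mul_step_mul_delay_le_one {η μ : ℝ} {τ : ℕ} (hμ : 0 < μ)
    (h : η ≤ 1 / (20 * μ * (τ + 1))) : 10 * (η * μ) * (τ + 1) ≤ 1 := by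
  rw [le_div_iff₀ (by positivity)] at h
  linarith

lemma ten_mul_step_mul_delay_le_one_of_tuned {η μ : ℝ} {τ T : ℕ} (hμ : 0 < μ) (hη : 0 ≤ η)
    (hT : T = τ ∨ T = τ + 1) (hT1 : 1 ≤ T) (h : η ≤ 1 / (20 * μ * T)) :
    10 * (η * μ) * (τ + 1) ≤ 1 := by
  have hT1' : (1 : ℝ) ≤ T := by exact_mod_cast hT1
  have hτT : (τ : ℝ) + 1 ≤ 2 * T := by
    have : τ + 1 ≤ 2 * T := by omega
    exact_mod_cast this
  rw [le_div_iff₀ (by positivity)] at h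
  have := mul_le_mul_of_nonneg_left hτT (mul_nonneg hη hμ.le)
  linarith

lemma one_le_of_delay_mul_log_le {τ k : ℕ}
    (h : ((τ : ℝ) + 1) * Real.log (2 * ((τ : ℝ) + 1)) ≤ k) : (1 : ℝ) ≤ k := by
  have hτ : (0 : ℝ) ≤ τ := τ.cast_nonneg
  have h1 : 0 < ((τ : ℝ) + 1) * Real.log (2 * ((τ : ℝ) + 1)) :=
    mul_pos (by positivity) (Real.log_pos (by linarith))
  have : 0 < k := by exact_mod_cast h1.trans_le h
  exact_mod_cast this

lemma five_lt_two_mul_exp_one : 5 < 2 * Real.exp 1 := by linarith [Real.exp_one_gt_d9]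

/-- The strongly convex bound with numerical constants rounded up, in the form used for tuning. -/
lemma SDGDGuarantee.strongly_convex_simple {lam μ σ η R : ℝ} {τ : ℕ} (k : ℕ) (hlam : 0 < lam)
    (hμ : 0 < μ) (hη : 0 < η) (hητ : 10 * (η * μ) * (τ + 1) ≤ 1) (hk : (1 : ℝ) ≤ k) :
    SDGDGuarantee.{u} lam μ σ τ η R k
      (μ * R ^ 2 * Real.exp (-(2 * η * lam * k)) + η * σ ^ 2 * (1 + Real.log (1 + k))) := by
  refine (SDGDGuarantee.strongly_convex_log_time k hlam hη hητ).mono ?_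
  have hexp : Real.exp (-2 * η * lam * (k + 1)) ≤ Real.exp (-(2 * η * lam * k)) := by
    refine Real.exp_le_exp.2 ?_
    have : 0 < η * lam := by positivity
    linarith
  have hlog : Real.log k ≤ Real.log (1 + k) := Real.log_le_log (by linarith) (by linarith)
  have hlog0 : 0 ≤ Real.log k := Real.log_nonneg hk
  have hbias := mul_le_mul_of_nonneg_left hexp (show 0 ≤ μ * R ^ 2 by positivity)
  have hvar : η ^ 2 * σ ^ 2 * (1 / (2 * Real.exp 1 * η) * (1 + Real.log k))
      ≤ η * σ ^ 2 * (1 + Real.log (1 + k)) := by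
    have h1 : η ^ 2 * σ ^ 2 * (1 / (2 * Real.exp 1 * η) * (1 + Real.log k))
        = η * σ ^ 2 * (1 + Real.log k) / (2 * Real.exp 1) := by field_simp
    rw [h1]
    refine (div_le_self (by positivity) (by linarith [five_lt_two_mul_exp_one])).trans ?_
    gcongr
  have h0 : 0 ≤ μ * R ^ 2 * Real.exp (-(2 * η * lam * k)) := by positivity
  have h0' : 0 ≤ η * σ ^ 2 * (1 + Real.log (1 + k)) :=
    mul_nonneg (by positivity) (by linarith)
  linarith

/-- The convex bound with numerical constants rounded up, in the form used for tuning. -/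
lemma SDGDGuarantee.convex_simple {μ σ η R : ℝ} {τ : ℕ} (k : ℕ)
    (hη : 0 < η) (hητ : 10 * (η * μ) * (τ + 1) ≤ 1) (hk : (1 : ℝ) ≤ k) :
    SDGDGuarantee.{u} 0 μ σ τ η R k
      (R ^ 2 / (η * k) + η * σ ^ 2 * (1 + Real.log (1 + k))) := by
  refine (SDGDGuarantee.convex k hη hητ).mono ?_
  have hk0 : (0 : ℝ) < k := by linarith
  have hlog : Real.log k ≤ Real.log (1 + k) := Real.log_le_log (by linarith) (by linarith)
  have hlog0 : 0 ≤ Real.log k := Real.log_nonneg hk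
  have hbias : R ^ 2 * (1 / (2 * Real.exp 1 * η) * (1 / ((k : ℝ) + 1))) ≤ R ^ 2 / (η * k) := by
    have h1 : R ^ 2 * (1 / (2 * Real.exp 1 * η) * (1 / ((k : ℝ) + 1)))
        = R ^ 2 / (η * (k + 1)) / (2 * Real.exp 1) := by field_simp
    rw [h1]
    refine (div_le_self (by positivity) (by linarith [five_lt_two_mul_exp_one])).trans ?_
    gcongr
    linarith
  have hvar : η ^ 2 * σ ^ 2 * (1 / (2 * Real.exp 1 * η) * (1 + Real.log k))
      ≤ η * σ ^ 2 * (1 + Real.log (1 + k)) := by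
    have h1 : η ^ 2 * σ ^ 2 * (1 / (2 * Real.exp 1 * η) * (1 + Real.log k))
        = η * σ ^ 2 * (1 + Real.log k) / (2 * Real.exp 1) := by field_simp
    rw [h1]
    refine (div_le_self (by positivity) (by linarith [five_lt_two_mul_exp_one])).trans ?_
    gcongr
  have h0 : 0 ≤ R ^ 2 / (η * k) := by positivity
  have h0' : 0 ≤ η * σ ^ 2 * (1 + Real.log (1 + k)) :=
    mul_nonneg (by positivity) (by linarith)
  linarith

/-! ### Tuned step sizes -/

/-- The tuned step size for the strongly convex bound: the largest admissible one, unless the noise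
dominates, when `exp (-2 η λ k)` has to be of the order of `σ² / (λ μ R² k)`. -/
lemma exists_step_strongly_convex {lam μ σ R k M L : ℝ} (hlam : 0 < lam) (hμ : 0 < μ)
    (hk : 0 < k) (hM : 0 < M)
    (hL : 1 + Real.log (1 + lam * μ * R ^ 2 * k / σ ^ 2) ≤ L) :
    ∃ η, 0 < η ∧ η ≤ 1 / (20 * μ * M) ∧
      μ * R ^ 2 * Real.exp (-(2 * η * lam * k))
        ≤ σ ^ 2 / (lam * k) + μ * R ^ 2 * Real.exp (-(lam * k / (10 * μ * M))) ∧
      η * σ ^ 2 ≤ L * (σ ^ 2 / (lam * k)) := by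
  set Q := lam * μ * R ^ 2 * k / σ ^ 2 with hQ
  have hQ0 : 0 ≤ Q := by positivity
  have hlogQ : 0 ≤ Real.log (1 + Q) := Real.log_nonneg (by linarith)
  have hmax : μ * R ^ 2 * Real.exp (-(2 * (1 / (20 * μ * M)) * lam * k))
      ≤ σ ^ 2 / (lam * k) + μ * R ^ 2 * Real.exp (-(lam * k / (10 * μ * M))) := by
    have h1 : 2 * (1 / (20 * μ * M)) * lam * k = lam * k / (10 * μ * M) := by field_simp; norm_num
    rw [h1]
    linarith [show 0 ≤ σ ^ 2 / (lam * k) by positivity]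
  -- For `σ = 0` the quotient `Q` is `0` by convention and must not limit the step size.
  rcases eq_or_ne σ 0 with hσ | hσ
  · exact ⟨1 / (20 * μ * M), by positivity, le_rfl, hmax, by simp [hσ]⟩
  -- `1 + log (1 + Q)` instead of `log Q` keeps the step size positive when `Q` is small.
  have hnoise : ∀ η, η ≤ (1 + Real.log (1 + Q)) / (2 * lam * k) →
      η * σ ^ 2 ≤ L * (σ ^ 2 / (lam * k)) := by
    intro η h
    have h2 : (1 + Real.log (1 + Q)) / (2 * lam * k) ≤ L / (lam * k) := by
      rw [div_le_div_iff₀ (by positivity) (by positivity)]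
      have : 0 < lam * k := by positivity
      nlinarith
    calc η * σ ^ 2 ≤ L / (lam * k) * σ ^ 2 :=
          mul_le_mul_of_nonneg_right (h.trans h2) (sq_nonneg _)
      _ = _ := by ring
  rcases le_total (1 / (20 * μ * M)) ((1 + Real.log (1 + Q)) / (2 * lam * k)) with h | h
  · exact ⟨_, by positivity, le_rfl, hmax, hnoise _ h⟩
  · refine ⟨_, by positivity, h, ?_, hnoise _ le_rfl⟩
    have h1 : 2 * ((1 + Real.log (1 + Q)) / (2 * lam * k)) * lam * k = 1 + Real.log (1 + Q) := by
      field_simp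
    have h2 : Real.exp (-(1 + Real.log (1 + Q))) ≤ 1 / (1 + Q) := by
      rw [one_div, ← Real.exp_log (show 0 < (1 + Q)⁻¹ by positivity), Real.log_inv]
      exact Real.exp_le_exp.2 (by linarith)
    have h3 : μ * R ^ 2 = Q * (σ ^ 2 / (lam * k)) := by rw [hQ]; field_simp
    have h4 : Q * (1 / (1 + Q)) ≤ 1 := by
      rw [mul_one_div, div_le_one (by positivity)]; linarith
    rw [h1]
    have h5 : μ * R ^ 2 * Real.exp (-(1 + Real.log (1 + Q))) ≤ σ ^ 2 / (lam * k) := by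
      calc μ * R ^ 2 * Real.exp (-(1 + Real.log (1 + Q)))
          ≤ μ * R ^ 2 * (1 / (1 + Q)) := mul_le_mul_of_nonneg_left h2 (by positivity)
        _ = Q * (1 / (1 + Q)) * (σ ^ 2 / (lam * k)) := by rw [h3]; ring
        _ ≤ 1 * (σ ^ 2 / (lam * k)) := mul_le_mul_of_nonneg_right h4 (by positivity)
        _ = _ := one_mul _
    linarith [show 0 ≤ μ * R ^ 2 * Real.exp (-(lam * k / (10 * μ * M))) by positivity]

/-- The step size balancing the two terms of the convex bound, capped at the largest admissible
one. -/
lemma exists_step_convex {μ σ R k M : ℝ} (hμ : 0 < μ) (hσ : 0 ≤ σ) (hR : 0 < R)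
    (hk : 0 < k) (hM : 0 < M) :
    ∃ η, 0 < η ∧ η ≤ 1 / (20 * μ * M) ∧
      R ^ 2 / (η * k) ≤ 20 * (R * σ / √k + R ^ 2 * μ * M / k) ∧
      η * σ ^ 2 ≤ R * σ / √k := by
  have hsq : 0 < √k := Real.sqrt_pos.2 hk
  have ha : 0 ≤ R * σ / √k := by positivity
  have hb : 0 ≤ R ^ 2 * μ * M / k := by positivity
  have hmax : R ^ 2 / (1 / (20 * μ * M) * k) ≤ 20 * (R * σ / √k + R ^ 2 * μ * M / k) := by
    have h1 : R ^ 2 / (1 / (20 * μ * M) * k) = 20 * (R ^ 2 * μ * M / k) := by field_simp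
    linarith
  rcases hσ.eq_or_lt with hσ0 | hσ0
  · exact ⟨1 / (20 * μ * M), by positivity, le_rfl, hmax, by simp [← hσ0]⟩
  have hbal : R / (σ * √k) * σ ^ 2 = R * σ / √k := by field_simp
  rcases le_total (1 / (20 * μ * M)) (R / (σ * √k)) with h | h
  · exact ⟨_, by positivity, le_rfl, hmax,
      (mul_le_mul_of_nonneg_right h (sq_nonneg σ)).trans_eq hbal⟩
  · refine ⟨_, by positivity, h, ?_, hbal.le⟩
    have h1 : R ^ 2 / (R / (σ * √k) * k) = R * σ / √k := by
      nth_rewrite 2 [← Real.sq_sqrt hk.le]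
      field_simp
    linarith

theorem theorem4 :
    (∀ (τ k : ℕ) (lam μ σ η R : ℝ), 0 < lam → lam ≤ μ → 0 ≤ σ → 0 ≤ R →
      0 < η → η ≤ 1 / (20 * μ * (τ + 1)) →
      ((τ : ℝ) + 1) * Real.log (2 * ((τ : ℝ) + 1)) ≤ k →
      SDGDGuarantee.{u} lam μ σ τ η R k
        (5 * μ * Real.exp (-2 * η * lam * (k + 1)) * R ^ 2
          + η ^ 2 * σ ^ 2 / 2 *
            (μ * (τ + 1) * Real.log (2 * (τ + 1))
              + (1 + Real.exp 1 + Real.log (1 / (η * lam))) / (Real.exp 1 * η)))) ∧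
    (∃ (C : ℝ) (p : ℕ), 0 < C ∧
      ∀ (τ T k : ℕ) (lam μ σ R : ℝ), 0 < lam → lam ≤ μ → 0 ≤ σ → 0 ≤ R →
        (T = τ ∨ T = τ + 1) → 1 ≤ T →
        ((τ : ℝ) + 1) * Real.log (2 * ((τ : ℝ) + 1)) ≤ k →
        ∃ η : ℝ, 0 < η ∧ η ≤ 1 / (20 * μ * T) ∧
          SDGDGuarantee.{u} lam μ σ τ η R k
            (C * (1 + Real.log (1 + k) + Real.log (1 + lam * μ * R ^ 2 * k / σ ^ 2)) ^ p *
              (σ ^ 2 / (lam * k) + μ * R ^ 2 * Real.exp (-(lam * k / (10 * μ * T)))))) ∧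
    (∀ (τ k : ℕ) (μ σ η R : ℝ), 0 < μ → 0 ≤ σ → 0 ≤ R →
      0 < η → η ≤ 1 / (20 * μ * (τ + 1)) →
      ((τ : ℝ) + 1) * Real.log (2 * ((τ : ℝ) + 1)) ≤ k →
      SDGDGuarantee.{u} 0 μ σ τ η R k
        (9 * R ^ 2 / (4 * Real.exp 1 * η * (k + 1))
          + η ^ 2 * σ ^ 2 *
            (μ * (τ + 1) * Real.log (2 * (τ + 1))
              + 9 / (2 * Real.exp 1 * η) * (1 + Real.log (k + 1))))) ∧
    (∃ (C : ℝ) (p : ℕ), 0 < C ∧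
      ∀ (τ T k : ℕ) (μ σ R : ℝ), 0 < μ → 0 ≤ σ → 0 ≤ R →
        (T = τ ∨ T = τ + 1) → 1 ≤ T →
        ((τ : ℝ) + 1) * Real.log (2 * ((τ : ℝ) + 1)) ≤ k →
        ∃ η : ℝ, 0 ≤ η ∧ (0 < R → 0 < η) ∧ η ≤ 1 / (20 * μ * T) ∧
          SDGDGuarantee.{u} 0 μ σ τ η R k
            (C * (1 + Real.log (1 + k)) ^ p *
              (R * σ / Real.sqrt k + R ^ 2 * μ * T / k))) := by
  refine ⟨?_, ⟨2, 2, by norm_num, ?_⟩, ?_, ⟨21, 1, by norm_num, ?_⟩⟩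
  · intro τ k lam μ σ η R hlam hlamμ _ _ hη hημ _
    have hμ : 0 < μ := hlam.trans_le hlamμ
    have hητ := ten_mul_step_mul_delay_le_one hμ hημ
    refine (SDGDGuarantee.strongly_convex k hlam hη hητ).mono ?_
    have hτ : (0 : ℝ) ≤ τ := τ.cast_nonneg
    have hx : η * lam ≤ 1 / 10 := by
      have h1 : η * lam ≤ η * μ := mul_le_mul_of_nonneg_left hlamμ hη.le
      have h2 : 0 ≤ η * μ * τ := by positivity
      linarith
    have hx0 : 0 < η * lam := by positivity
    have hlog : Real.log (1 / (η * lam / 2)) = Real.log 2 + Real.log (1 / (η * lam)) := by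
      rw [← Real.log_mul (by norm_num) (by positivity)]
      congr 1
      field_simp
    have hlog0 : 0 ≤ Real.log (1 / (η * lam)) :=
      Real.log_nonneg (by rw [le_div_iff₀ hx0]; linarith)
    have hdelay : 0 ≤ μ * (τ + 1) * Real.log (2 * ((τ : ℝ) + 1)) :=
      mul_nonneg (by positivity) (Real.log_nonneg (by linarith))
    have hvar : 5 / 8 * (2 / (3 * Real.exp 1 * η) *
          (Real.log (1 / (η * lam / 2)) + η * lam / 2))
        ≤ 1 / 2 * ((1 + Real.exp 1 + Real.log (1 / (η * lam))) / (Real.exp 1 * η)) := by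
      have h1 : 5 / 8 * (2 / (3 * Real.exp 1 * η) *
          (Real.log (1 / (η * lam / 2)) + η * lam / 2))
        = 5 / 12 * (Real.log 2 + Real.log (1 / (η * lam)) + η * lam / 2)
          / (Real.exp 1 * η) := by
        rw [hlog]; field_simp; norm_num
      rw [h1, ← mul_div_assoc]
      refine div_le_div_of_nonneg_right ?_ (by positivity)
      linarith [Real.log_two_lt_d9, Real.exp_pos 1]
    have hvar' := mul_le_mul_of_nonneg_left hvar (show 0 ≤ η ^ 2 * σ ^ 2 by positivity)
    have hdelay' := mul_nonneg (show 0 ≤ η ^ 2 * σ ^ 2 by positivity) hdelay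
    have hbias : 0 ≤ μ * Real.exp (-2 * η * lam * (k + 1)) * R ^ 2 := by positivity
    linarith
  · intro τ T k lam μ σ R hlam hlamμ _ _ hT hT1 hk
    have hμ : 0 < μ := hlam.trans_le hlamμ
    have hk1 := one_le_of_delay_mul_log_le hk
    have hT0 : (0 : ℝ) < T := by exact_mod_cast hT1
    have hlogk : 0 ≤ Real.log (1 + k) := Real.log_nonneg (by linarith)
    have hQ : 0 ≤ lam * μ * R ^ 2 * k / σ ^ 2 := by positivity
    have hlogQ : 0 ≤ Real.log (1 + lam * μ * R ^ 2 * k / σ ^ 2) :=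
      Real.log_nonneg (by linarith)
    set L := 1 + Real.log (1 + k) + Real.log (1 + lam * μ * R ^ 2 * k / σ ^ 2) with hL
    have hL1 : 1 ≤ L := by linarith
    obtain ⟨η, hη, hηT, hbias, hvar⟩ := exists_step_strongly_convex (L := L) (R := R) (σ := σ)
      hlam hμ (by linarith : (0 : ℝ) < k) hT0 (by linarith)
    refine ⟨η, hη, hηT, (SDGDGuarantee.strongly_convex_simple k hlam hμ hη
      (ten_mul_step_mul_delay_le_one_of_tuned hμ hη.le hT hT1 hηT) hk1).mono ?_⟩
    have hV : 0 ≤ σ ^ 2 / (lam * k) := by positivity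
    have hE : 0 ≤ μ * R ^ 2 * Real.exp (-(lam * k / (10 * μ * T))) := by positivity
    set V := σ ^ 2 / (lam * k)
    set E := μ * R ^ 2 * Real.exp (-(lam * k / (10 * μ * T)))
    have h1 : η * σ ^ 2 * (1 + Real.log (1 + k)) ≤ L * V * L :=
      mul_le_mul hvar (by linarith) (by linarith) (by positivity)
    have hL2 : 1 ≤ L ^ 2 := one_le_pow₀ hL1
    have h2 : V + E ≤ L ^ 2 * (V + E) := le_mul_of_one_le_left (by linarith) hL2
    have h3 : 0 ≤ L ^ 2 * E := by positivity
    linarith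
  · intro τ k μ σ η R hμ _ _ hη hημ hk
    have hk1 := one_le_of_delay_mul_log_le hk
    have hτ : (0 : ℝ) ≤ τ := τ.cast_nonneg
    refine (SDGDGuarantee.convex k hη (ten_mul_step_mul_delay_le_one hμ hημ)).mono ?_
    have hlog : Real.log k ≤ Real.log (k + 1) := Real.log_le_log (by linarith) (by linarith)
    have hlog0 : 0 ≤ Real.log k := Real.log_nonneg hk1
    have hdelay : 0 ≤ μ * (τ + 1) * Real.log (2 * ((τ : ℝ) + 1)) :=
      mul_nonneg (by positivity) (Real.log_nonneg (by linarith))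
    have hbias : 5 / 8 * (R ^ 2 * (1 / (2 * Real.exp 1 * η) * (1 / ((k : ℝ) + 1))))
        ≤ 9 * R ^ 2 / (4 * Real.exp 1 * η * (k + 1)) := by
      have h1 : 9 * R ^ 2 / (4 * Real.exp 1 * η * (k + 1))
          = 9 / 2 * (R ^ 2 * (1 / (2 * Real.exp 1 * η) * (1 / ((k : ℝ) + 1)))) := by
        field_simp; norm_num
      rw [h1]
      exact mul_le_mul_of_nonneg_right (by norm_num) (by positivity)
    have hvar : 5 / 8 * (1 / (2 * Real.exp 1 * η) * (1 + Real.log k))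
        ≤ 9 / (2 * Real.exp 1 * η) * (1 + Real.log (k + 1)) := by
      rw [← mul_assoc, mul_one_div]
      gcongr
      norm_num
    have hvar' := mul_le_mul_of_nonneg_left hvar (show 0 ≤ η ^ 2 * σ ^ 2 by positivity)
    have hdelay' := mul_nonneg (show 0 ≤ η ^ 2 * σ ^ 2 by positivity) hdelay
    linarith
  · intro τ T k μ σ R hμ hσ hR hT hT1 hk
    have hk1 := one_le_of_delay_mul_log_le hk
    have hT0 : (0 : ℝ) < T := by exact_mod_cast hT1
    rcases hR.eq_or_lt with rfl | hR
    · -- Started at a minimizer, the iteration with step size `0` stays there.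
      refine ⟨0, le_rfl, fun h => absurd h (lt_irrefl _), by positivity,
        SDGDGuarantee.of_exp_bound (β := μ) (s := fun _ => μ) le_rfl le_rfl (by simp)
          (fun a ha => by simpa using ha.2) (fun m a ha => by simpa using ha.2)
          (fun _ => hμ.le) (by simp)⟩
    obtain ⟨η, hη, hηT, hbias, hvar⟩ := exists_step_convex (R := R) (σ := σ)
      hμ hσ hR (by linarith : (0 : ℝ) < k) hT0
    refine ⟨η, hη.le, fun _ => hη, hηT, (SDGDGuarantee.convex_simple k hη
      (ten_mul_step_mul_delay_le_one_of_tuned hμ hη.le hT hT1 hηT) hk1).mono ?_⟩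
    have hV : 0 ≤ R * σ / √k := by positivity
    have hE : 0 ≤ R ^ 2 * μ * T / k := by positivity
    have hL : 1 ≤ 1 + Real.log (1 + k) := by
      linarith [Real.log_nonneg (show (1 : ℝ) ≤ 1 + k by linarith)]
    set L := 1 + Real.log (1 + (k : ℝ))
    set V := R * σ / √k
    set E := R ^ 2 * μ * T / k
    have h1 : η * σ ^ 2 * L ≤ V * L := mul_le_mul_of_nonneg_right hvar (by linarith)
    have h2 : V + E ≤ L * (V + E) := le_mul_of_one_le_left (by linarith) hL
    have h3 : 0 ≤ L * E := mul_nonneg (by linarith) hE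
    rw [pow_one]
    linarith
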